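/- For integers $r,s\ge 3$ and $\ell\ge 1$, let $D_{r,s,\ell}$ be the dumbbell graph, obtained from two vertex-disjoint cycles $C_r$ and $C_s$ by choosing one vertex on each and joining the two chosen vertices by a path of length $\ell$; it has $r+s+\ell-1$ vertices. A complex unit gain graph $\Phi=(D_{r,s,\ell},\varphi)$ assigns to every oriented edge $(u,v)$ a complex number $\varphi(u,v)$ of modulus $1$ with $\varphi(v,u)=\varphi(u,v)^{-1}$. Its Hermitian adjacency matrix $A(\Phi)$ has $(u,v)$ entry $\varphi(u,v)$ if $u,v$ are adjacent and $0$ otherwise, and its energy is $E(\Phi)=\sum_j|\lambda_j|$, where the $\lambda_j$ are the eigenvalues of $A(\Phi)$ counted with multiplicity. Let $\gamma_r=\varphi(C_r)$ and $\gamma_s=\varphi(C_s)$ be the products of the gains of the edges along the two cycles, each traversed once (the real parts do not depend on the direction or the starting vertex). **Theorem.** Let $r,s\ge 3$ be odd, let $\ell\ge 1$, and for a complex unit gain graph $\Phi$ on $D_{r,s,\ell}$ put $$\alpha=(-1)^{(r+1)/2}\operatorname{Re}\gamma_r,\qquad \beta=(-1)^{(s+1)/2}\operatorname{Re}\gamma_s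 .$$ (a) If $\ell$ is even, then $\Phi$ attains the maximum of $E$ over all complex unit gain graphs on $D_{r,s,\ell}$ if and only if $(\alpha,\beta)=(1,1)$ or $(\alpha,\beta)=(-1,-1)$. (b) If $\ell$ is odd, then $\Phi$ attains the maximum of $E$ over all complex unit gain graphs on $D_{r,s,\ell}$ if and only if $(\alpha,\beta)=(1,-1)$ or $(\alpha,\beta)=(-1,1)$. In each case, both of the pairs listed occur for some $\Phi$, so the maximum is attained, and it is attained at both pairs. -/

import Mathlib

/-- A complex unit gain on a simple graph `G`: every oriented edge (dart) receives a complex number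
of modulus one, and reversing the orientation inverts the gain. -/
structure UnitGain {V : Type*} (G : SimpleGraph V) where
  gain : G.Dart → Circle
  gain_symm : ∀ d : G.Dart, gain d.symm = (gain d)⁻¹

namespace UnitGain

variable {V : Type*} {G : SimpleGraph V}

open Classical in
/-- The Hermitian adjacency matrix: the `(u, v)` entry is the gain of the oriented edge `(u, v)` if
`u` and `v` are adjacent, and `0` otherwise. -/
noncomputable def adjMatrix (Φ : UnitGain G) : Matrix V V ℂ :=
  Matrix.of fun u v => if h : G.Adj u v then (Φ.gain ⟨(u, v), h⟩ : ℂ) else 0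

theorem adjMatrix_isHermitian (Φ : UnitGain G) : Φ.adjMatrix.IsHermitian := by
  ext u v
  simp only [adjMatrix, Matrix.conjTranspose_apply, Matrix.of_apply]
  by_cases h : G.Adj u v
  · rw [dif_pos h, dif_pos h.symm]
    have := Φ.gain_symm ⟨(u, v), h⟩
    have h2 : (⟨(u, v), h⟩ : G.Dart).symm = ⟨(v, u), h.symm⟩ := rfl
    rw [h2] at this
    rw [this, Circle.coe_inv_eq_conj]
    simp
  · rw [dif_neg h, dif_neg (fun h' => h h'.symm)]
    simp

/-- The energy: the sum of the absolute values of the eigenvalues (with multiplicity) of the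
Hermitian adjacency matrix. -/
noncomputable def energy [Fintype V] [DecidableEq V] (Φ : UnitGain G) : ℝ :=
  ∑ j, |Φ.adjMatrix_isHermitian.eigenvalues j|

end UnitGain

/-- The oriented edge `(i, i + 1)` (indices modulo `n`) of the cycle `C_n`. -/
def cycleDart (n : ℕ) (hn : 3 ≤ n) (i : Fin n) : (SimpleGraph.cycleGraph n).Dart :=
  ⟨(i, finRotate n i), by
    obtain ⟨m, rfl⟩ : ∃ m, n = m + 2 := ⟨n - 2, by omega⟩
    simp [SimpleGraph.cycleGraph_adj]⟩

/-- The gain of a cycle `c` of length `n` in `G`: the product of the gains of its consecutive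
oriented edges `(c 0, c 1), …, (c (n - 2), c (n - 1)), (c (n - 1), c 0)`. -/
noncomputable def UnitGain.cycleGain {V : Type*} {G : SimpleGraph V} (Φ : UnitGain G)
    {n : ℕ} (hn : 3 ≤ n) (c : SimpleGraph.cycleGraph n ↪g G) : Circle :=
  ∏ i : Fin n, Φ.gain (c.toHom.mapDart (cycleDart n hn i))

/-- The dumbbell graph `D_{r,s,ℓ}` on the vertices `0, 1, …, r + s + ℓ - 2`. Consecutive vertices
are adjacent, and there are two more edges, `{0, r - 1}` and `{r + ℓ - 1, r + s + ℓ - 2}`.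
Thus `0, …, r - 1` form the cycle `C_r`, the vertices `r + ℓ - 1, …, r + s + ℓ - 2` form the cycle
`C_s`, and `r - 1, r, …, r + ℓ - 1` is the path of length `ℓ` that joins them. -/
def dumbbell (r s ℓ : ℕ) : SimpleGraph (Fin (r + s + ℓ - 1)) :=
  SimpleGraph.fromRel fun i j =>
    (i : ℕ) + 1 = j ∨
    ((i : ℕ) = 0 ∧ (j : ℕ) + 1 = r) ∨
    ((i : ℕ) + 1 = r + ℓ ∧ (j : ℕ) + 2 = r + s + ℓ)

theorem cycleGraph_adj_val {n : ℕ} (hn : 3 ≤ n) (i j : Fin n) :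
    (SimpleGraph.cycleGraph n).Adj i j ↔
      (i : ℕ) + 1 = j ∨ (j : ℕ) + 1 = i ∨
        ((i : ℕ) = 0 ∧ (j : ℕ) + 1 = n) ∨ ((j : ℕ) = 0 ∧ (i : ℕ) + 1 = n) := by
  rw [SimpleGraph.cycleGraph_adj']
  have hi := i.isLt
  have hj := j.isLt
  rcases lt_trichotomy (i : ℕ) j with h | h | h
  · rw [Fin.coe_sub_iff_lt.2 h, Fin.coe_sub_iff_le.2 h.le]
    omega
  · have : i = j := Fin.ext h
    subst this
    rw [Fin.coe_sub_iff_le.2 le_rfl]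
    omega
  · rw [Fin.coe_sub_iff_lt.2 h, Fin.coe_sub_iff_le.2 h.le]
    omega

/-- The cycle `C_r` of the dumbbell graph. -/
def dumbbellLeft (r s ℓ : ℕ) (hr : 3 ≤ r) (hs : 3 ≤ s) :
    SimpleGraph.cycleGraph r ↪g dumbbell r s ℓ where
  toFun i := ⟨i, by omega⟩
  inj' i j h := by simpa [Fin.ext_iff] using h
  map_rel_iff' {i j} := by
    rw [cycleGraph_adj_val hr]
    simp only [dumbbell, SimpleGraph.fromRel_adj, ne_eq, Fin.ext_iff]
    dsimp only [DFunLike.coe]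
    omega

/-- The cycle `C_s` of the dumbbell graph. -/
def dumbbellRight (r s ℓ : ℕ) (hr : 3 ≤ r) (hs : 3 ≤ s) :
    SimpleGraph.cycleGraph s ↪g dumbbell r s ℓ where
  toFun i := ⟨r + ℓ - 1 + i, by omega⟩
  inj' i j h := by simpa [Fin.ext_iff] using h
  map_rel_iff' {i j} := by
    rw [cycleGraph_adj_val hs]
    simp only [dumbbell, SimpleGraph.fromRel_adj, ne_eq, Fin.ext_iff]
    dsimp only [DFunLike.coe]
    omega

/-- `α = (-1)^((r+1)/2) Re γ_r`, where `γ_r` is the gain of the cycle `C_r` (used for odd `r`). -/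
noncomputable def oddAlpha {r s ℓ : ℕ} (hr : 3 ≤ r) (hs : 3 ≤ s)
    (Φ : UnitGain (dumbbell r s ℓ)) : ℝ :=
  (-1) ^ ((r + 1) / 2) * (Φ.cycleGain hr (dumbbellLeft r s ℓ hr hs) : ℂ).re

/-- `β = (-1)^((s+1)/2) Re γ_s`, where `γ_s` is the gain of the cycle `C_s` (used for odd `s`). -/
noncomputable def oddBeta {r s ℓ : ℕ} (hr : 3 ≤ r) (hs : 3 ≤ s)
    (Φ : UnitGain (dumbbell r s ℓ)) : ℝ :=
  (-1) ^ ((s + 1) / 2) * (Φ.cycleGain hs (dumbbellRight r s ℓ hr hs) : ℂ).re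

/-!
By Coulson's integral, the energy of a gain graph equals `π⁻¹ ∫ log (|p(it)|² / t ^ (2N))` over
`t > 0`, where `p` is the characteristic polynomial and `N` the number of vertices, so pointwise
larger `|p(it)|` means larger energy. For the dumbbell graph, Cassini's identity for the Chebyshev
polynomials `S n` gives
`S (ℓ - 1) * p = (P * S (ℓ - 1) - S (r - 1) * S (ℓ - 2)) * (Q * S (ℓ - 1) - S (s - 1) * S (ℓ - 2)) -
  S (r - 1) * S (s - 1)`,
where `P` and `Q` are the characteristic polynomials of the two cycles, in which the gains enter
only through the constant terms `-2 Re γ`. At `it` with `r` and `s` odd, the squared modulus of the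
right-hand side is a polynomial in `α` and `β` with nonnegative coefficients at `α ^ 2`, `β ^ 2`,
`α ^ 2 * β ^ 2` and `(-1) ^ ℓ * α * β`, the last one positive. All four terms are maximal at once
exactly when `(-1) ^ ℓ * α * β = 1`.
-/

section Coulson

open MeasureTheory Set Filter Topology Polynomial

theorem continuous_mul_log_one_add_sq_div {c : ℝ} (hc : c ≠ 0) :
    Continuous fun t : ℝ => t * Real.log (1 + (c / t) ^ 2) := by
  have h : Continuous fun t : ℝ => t * Real.log (t ^ 2 + c ^ 2) - 2 * (t * Real.log t) := by
    have hlog : Continuous fun t : ℝ => Real.log (t ^ 2 + c ^ 2) :=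
      Continuous.log (by fun_prop) fun t => by positivity
    exact (continuous_id.mul hlog).sub (Real.continuous_mul_log.const_mul 2)
  refine h.congr fun t => ?_
  rcases eq_or_ne t 0 with rfl | ht
  · simp
  rw [show 1 + (c / t) ^ 2 = (t ^ 2 + c ^ 2) / t ^ 2 by field_simp,
    Real.log_div (by positivity) (by positivity), Real.log_pow]
  push_cast
  ring

theorem tendsto_mul_log_one_add_sq_div_atTop (c : ℝ) :
    Tendsto (fun t : ℝ => t * Real.log (1 + (c / t) ^ 2)) atTop (𝓝 0) := by
  refine squeeze_zero' ?_ ?_ ((tendsto_id (α := ℝ)).const_div_atTop (c ^ 2)) <;>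
    filter_upwards [eventually_gt_atTop 0] with t ht
  · exact mul_nonneg ht.le (Real.log_nonneg (le_add_of_nonneg_right (sq_nonneg _)))
  · calc t * Real.log (1 + (c / t) ^ 2) ≤ t * (c / t) ^ 2 := by
          gcongr
          linarith [Real.log_le_sub_one_of_pos (show 0 < 1 + (c / t) ^ 2 by positivity)]
      _ = c ^ 2 / t := by field_simp

theorem hasDerivAt_mul_log_one_add_sq_div_add_arctan {c t : ℝ} (hc : c ≠ 0) (ht : t ≠ 0) :
    HasDerivAt (fun t => t * Real.log (1 + (c / t) ^ 2) + 2 * c * Real.arctan (t / c))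
      (Real.log (1 + (c / t) ^ 2)) t := by
  have hne : 1 + (c / t) ^ 2 ≠ 0 := by positivity
  have hinv : HasDerivAt (fun t => 1 + (c / t) ^ 2) (2 * (c / t) * (-c / t ^ 2)) t := by
    simpa [div_eq_mul_inv] using ((((hasDerivAt_inv ht).const_mul c).pow 2).const_add 1)
  refine (((hasDerivAt_id t).mul (hinv.log hne)).add
    (((hasDerivAt_id t).div_const c).arctan.const_mul (2 * c))).congr_deriv ?_
  have hne_arctan : 1 + (t / c) ^ 2 ≠ 0 := by positivity
  simp only [id]
  field_simp [hne_arctan]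
  ring

theorem integrableOn_and_integral_log_one_add_sq_div (c : ℝ) :
    IntegrableOn (fun t => Real.log (1 + (c / t) ^ 2)) (Ioi 0) ∧
      ∫ t in Ioi 0, Real.log (1 + (c / t) ^ 2) = Real.pi * |c| := by
  wlog hc : 0 < c generalizing c
  · rcases eq_or_lt_of_le (not_lt.1 hc) with rfl | hc'
    · simp
    · simpa only [neg_div, neg_sq, abs_neg] using this (-c) (neg_pos.2 hc')
  set F : ℝ → ℝ := fun t => t * Real.log (1 + (c / t) ^ 2) + 2 * c * Real.arctan (t / c) with hF
  have hcont : Continuous F := (continuous_mul_log_one_add_sq_div hc.ne').add (by fun_prop)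
  have hderiv : ∀ t ∈ Ioi (0 : ℝ), HasDerivAt F (Real.log (1 + (c / t) ^ 2)) t := fun t ht =>
    hasDerivAt_mul_log_one_add_sq_div_add_arctan hc.ne' (ne_of_gt ht)
  have hnonneg : ∀ t ∈ Ioi (0 : ℝ), 0 ≤ Real.log (1 + (c / t) ^ 2) := fun t _ =>
    Real.log_nonneg (le_add_of_nonneg_right (sq_nonneg _))
  have hlim : Tendsto F atTop (𝓝 (Real.pi * c)) := by
    have harctan : Tendsto (fun t => Real.arctan (t / c)) atTop (𝓝 (Real.pi / 2)) :=
      (tendsto_nhds_of_tendsto_nhdsWithin Real.tendsto_arctan_atTop).comp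
        (tendsto_id.atTop_div_const hc)
    convert (tendsto_mul_log_one_add_sq_div_atTop c).add (harctan.const_mul (2 * c)) using 2
    ring
  refine ⟨integrableOn_Ioi_deriv_of_nonneg hcont.continuousWithinAt hderiv hnonneg hlim, ?_⟩
  rw [integral_Ioi_of_hasDerivAt_of_nonneg hcont.continuousWithinAt hderiv hnonneg hlim,
    abs_of_pos hc]
  simp [hF]

variable {V : Type*} [Fintype V] [DecidableEq V] {A B : Matrix V V ℂ}

theorem normSq_eval_charpoly_mul_I (hA : A.IsHermitian) (t : ℝ) :
    Complex.normSq (A.charpoly.eval (Complex.I * t)) = ∏ j, (t ^ 2 + hA.eigenvalues j ^ 2) := by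
  rw [hA.charpoly_eq, eval_prod, map_prod]
  refine Finset.prod_congr rfl fun j _ => ?_
  simp only [Complex.coe_algebraMap, eval_sub, eval_X, eval_C, Complex.normSq_apply,
    Complex.sub_re, Complex.sub_im, Complex.re_mul_ofReal, Complex.im_mul_ofReal, Complex.I_re,
    Complex.I_im, Complex.ofReal_re, Complex.ofReal_im]
  ring

theorem normSq_eval_charpoly_mul_I_pos (hA : A.IsHermitian) {t : ℝ} (ht : 0 < t) :
    0 < Complex.normSq (A.charpoly.eval (Complex.I * t)) := by
  rw [normSq_eval_charpoly_mul_I hA]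
  exact Finset.prod_pos fun j _ => by positivity

/-- The integrand of Coulson's formula for the sum of the absolute values of the eigenvalues. -/
noncomputable def coulsonIntegrand (A : Matrix V V ℂ) (t : ℝ) : ℝ :=
  Real.log (Complex.normSq (A.charpoly.eval (Complex.I * t)) / t ^ (2 * Fintype.card V))

theorem coulsonIntegrand_eq_sum (hA : A.IsHermitian) {t : ℝ} (ht : 0 < t) :
    coulsonIntegrand A t = ∑ j, Real.log (1 + (hA.eigenvalues j / t) ^ 2) := by
  rw [coulsonIntegrand, normSq_eval_charpoly_mul_I hA, pow_mul, ← Finset.card_univ,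
    ← Finset.prod_const, ← Finset.prod_div_distrib, Real.log_prod fun j _ => by positivity]
  refine Finset.sum_congr rfl fun j _ => ?_
  congr 1
  field_simp

theorem integrableOn_coulsonIntegrand (hA : A.IsHermitian) :
    IntegrableOn (coulsonIntegrand A) (Ioi 0) :=
  IntegrableOn.congr_fun
    (integrable_finsetSum _ fun j _ =>
      (integrableOn_and_integral_log_one_add_sq_div (hA.eigenvalues j)).1)
    (fun _ ht => (coulsonIntegrand_eq_sum hA ht).symm) measurableSet_Ioi

theorem integral_coulsonIntegrand (hA : A.IsHermitian) :
    ∫ t in Ioi 0, coulsonIntegrand A t = Real.pi * ∑ j, |hA.eigenvalues j| := by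
  rw [setIntegral_congr_fun measurableSet_Ioi fun t ht => coulsonIntegrand_eq_sum hA ht,
    integral_finsetSum _ fun j _ => (integrableOn_and_integral_log_one_add_sq_div _).1,
    Finset.mul_sum]
  exact Finset.sum_congr rfl fun j _ => (integrableOn_and_integral_log_one_add_sq_div _).2

theorem sum_abs_eigenvalues_le_of_normSq_le (hA : A.IsHermitian) (hB : B.IsHermitian)
    (h : ∀ t : ℝ, 0 < t → Complex.normSq (A.charpoly.eval (Complex.I * t)) ≤
      Complex.normSq (B.charpoly.eval (Complex.I * t))) :
    ∑ j, |hA.eigenvalues j| ≤ ∑ j, |hB.eigenvalues j| := by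
  refine le_of_mul_le_mul_left ?_ Real.pi_pos
  rw [← integral_coulsonIntegrand hA, ← integral_coulsonIntegrand hB]
  refine setIntegral_mono_on (integrableOn_coulsonIntegrand hA) (integrableOn_coulsonIntegrand hB)
    measurableSet_Ioi fun t (ht : 0 < t) => ?_
  have hpos := normSq_eval_charpoly_mul_I_pos hA ht
  exact Real.log_le_log (by positivity) (by gcongr; exact h t ht)

theorem sum_abs_eigenvalues_lt_of_normSq_lt (hA : A.IsHermitian) (hB : B.IsHermitian)
    (h : ∀ t : ℝ, 0 < t → Complex.normSq (A.charpoly.eval (Complex.I * t)) <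
      Complex.normSq (B.charpoly.eval (Complex.I * t))) :
    ∑ j, |hA.eigenvalues j| < ∑ j, |hB.eigenvalues j| := by
  refine lt_of_mul_lt_mul_left ?_ Real.pi_pos.le
  rw [← integral_coulsonIntegrand hA, ← integral_coulsonIntegrand hB, ← sub_pos,
    ← integral_sub (integrableOn_coulsonIntegrand hB) (integrableOn_coulsonIntegrand hA)]
  have hlt : ∀ t : ℝ, 0 < t → coulsonIntegrand A t < coulsonIntegrand B t := fun t ht => by
    have hpos := normSq_eval_charpoly_mul_I_pos hA ht
    exact Real.log_lt_log (by positivity) (by gcongr; exact h t ht)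
  have hsupport : Ioi 0 ⊆ Function.support fun t => coulsonIntegrand B t - coulsonIntegrand A t :=
    fun t ht => (sub_pos.2 (hlt t ht)).ne'
  rw [setIntegral_pos_iff_support_of_nonneg_ae
    (ae_restrict_of_forall_mem measurableSet_Ioi fun t ht => (sub_pos.2 (hlt t ht)).le)
    ((integrableOn_coulsonIntegrand hB).sub (integrableOn_coulsonIntegrand hA)),
    inter_eq_right.2 hsupport, Real.volume_Ioi]
  exact ENNReal.zero_lt_top

end Coulson

section Determinants

open Matrix

variable {R m n : Type*} [CommRing R] [Fintype m] [DecidableEq m] [Fintype n] [DecidableEq n]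

theorem det_updateRow_updateRow_swap (B : Matrix n n R) {i j : n} (hij : i ≠ j) (u v : n → R) :
    ((B.updateRow i v).updateRow j u).det = -((B.updateRow i u).updateRow j v).det := by
  have hswap : ((B.updateRow i u).updateRow j v).submatrix (Equiv.swap i j) id =
      (B.updateRow i v).updateRow j u := by
    ext k l
    rcases eq_or_ne k j with rfl | hkj
    · simp [updateRow_apply, hij]
    rcases eq_or_ne k i with rfl | hki
    · simp [updateRow_apply, hij]
    · simp [updateRow_apply, hkj, hki, Equiv.swap_apply_of_ne_of_ne hki hkj]
  rw [← hswap, det_permute, Equiv.Perm.sign_swap hij]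
  simp

theorem det_add_single_add_single (B : Matrix n n R) {i j : n} (hij : i ≠ j) (x y : R) :
    (B + single i j x + single j i y).det =
      B.det + x * B.adjugate j i + y * B.adjugate i j -
        x * y * ((B.updateRow i (Pi.single i 1)).updateRow j (Pi.single j 1)).det := by
  have hrows : B + single i j x + single j i y =
      (B.updateRow i (B i + x • Pi.single j 1)).updateRow j (B j + y • Pi.single i 1) := by
    ext k l
    rcases eq_or_ne k j with rfl | hkj
    · simp [single_apply, Pi.single_apply, hij, eq_comm]
    rcases eq_or_ne k i with rfl | hki
    · simp [single_apply, Pi.single_apply, hij, hij.symm, eq_comm]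
    · simp [hkj, hki, hkj.symm, hki.symm]
  have hrow_i (v : n → R) : (B.updateRow i v).updateRow j (B j) = B.updateRow i v := by
    rw [← updateRow_ne (M := B) (b := v) hij.symm, updateRow_eq_self]
  have hrow_j (v : n → R) : (B.updateRow i (B i)).updateRow j v = B.updateRow j v := by
    rw [updateRow_eq_self]
  have hadd (v : n → R) : ((B.updateRow i (B i + x • Pi.single j 1)).updateRow j v).det =
      (B.updateRow j v).det + x * ((B.updateRow i (Pi.single j 1)).updateRow j v).det := by
    rw [updateRow_comm _ hij, det_updateRow_add, det_updateRow_smul, updateRow_comm _ hij.symm,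
      updateRow_comm _ hij.symm, hrow_j]
  rw [hrows, det_updateRow_add, det_updateRow_smul, hadd, hadd, hrow_i, updateRow_eq_self,
    det_updateRow_updateRow_swap B hij (Pi.single i 1), adjugate_apply, adjugate_apply]
  ring

theorem det_fromBlocks_single_single (P : Matrix m m R) (Q : Matrix n n R) (a : m) (b : n)
    (c d : R) :
    (fromBlocks P (single a b c) (single b a d) Q).det =
      P.det * Q.det - c * d * (P.adjugate a a * Q.adjugate b b) := by
  have hblocks : fromBlocks P (single a b c) (single b a d) Q =
      fromBlocks P 0 0 Q + single (Sum.inl a) (Sum.inr b) c + single (Sum.inr b) (Sum.inl a) d := by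
    ext (i | i) (j | j) <;> simp [single_apply]
  have hrows : ((fromBlocks P 0 0 Q).updateRow (Sum.inl a) (Pi.single (Sum.inl a) 1)).updateRow
      (Sum.inr b) (Pi.single (Sum.inr b) 1) =
      fromBlocks (P.updateRow a (Pi.single a 1)) 0 0 (Q.updateRow b (Pi.single b 1)) := by
    ext (i | i) (j | j) <;> simp [updateRow_apply, Pi.single_apply]
  have hadj : (fromBlocks P 0 0 Q).adjugate (Sum.inr b) (Sum.inl a) = 0 := by
    have hrow : (fromBlocks P 0 0 Q).updateRow (Sum.inl a) (Pi.single (Sum.inr b) 1) =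
        fromBlocks (P.updateRow a 0) (single a b 1) 0 Q := by
      ext (i | i) (j | j) <;>
        simp [updateRow_apply, Pi.single_apply, single_apply, ite_and, eq_comm]
    rw [adjugate_apply, hrow, det_fromBlocks_zero₂₁,
      det_eq_zero_of_row_eq_zero a fun j => by simp, zero_mul]
  have hadj' : (fromBlocks P 0 0 Q).adjugate (Sum.inl a) (Sum.inr b) = 0 := by
    have hrow : (fromBlocks P 0 0 Q).updateRow (Sum.inr b) (Pi.single (Sum.inl a) 1) =
        fromBlocks P 0 (single b a 1) (Q.updateRow b 0) := by
      ext (i | i) (j | j) <;>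
        simp [updateRow_apply, Pi.single_apply, single_apply, ite_and, eq_comm]
    rw [adjugate_apply, hrow, det_fromBlocks_zero₁₂,
      det_eq_zero_of_row_eq_zero (A := Q.updateRow b 0) b fun j => by simp, mul_zero]
  rw [hblocks, det_add_single_add_single _ Sum.inl_ne_inr, hrows, det_fromBlocks_zero₂₁,
    det_fromBlocks_zero₂₁, hadj, hadj', adjugate_apply, adjugate_apply]
  ring

theorem neg_map_C_single {k l : Type*} [DecidableEq k] [DecidableEq l] (i : k) (j : l) (x : R) :
    -(single i j x).map Polynomial.C = single i j (-Polynomial.C x) := by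
  ext1 i' j'
  by_cases h : i = i' ∧ j = j' <;> simp [h]

theorem charpoly_fromBlocks_single_single (P : Matrix m m R) (Q : Matrix n n R) (a : m) (b : n)
    (c d : R) :
    (fromBlocks P (single a b c) (single b a d) Q).charpoly =
      P.charpoly * Q.charpoly -
        Polynomial.C (c * d) * (P.charmatrix.adjugate a a * Q.charmatrix.adjugate b b) := by
  rw [charpoly, charmatrix_fromBlocks, neg_map_C_single, neg_map_C_single,
    det_fromBlocks_single_single, neg_mul_neg, ← Polynomial.C_mul, charpoly, charpoly]

theorem charmatrix_submatrix_of_injective (A : Matrix m m R) {f : n → m}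
    (hf : Function.Injective f) :
    (charmatrix A).submatrix f f = charmatrix (A.submatrix f f) := by
  ext i j
  simp [charmatrix_apply, diagonal_apply, hf.eq_iff]

theorem adjugate_charmatrix_apply_self {k : ℕ} (A : Matrix (Fin (k + 1)) (Fin (k + 1)) R)
    (p : Fin (k + 1)) :
    (charmatrix A).adjugate p p = (A.submatrix p.succAbove p.succAbove).charpoly := by
  rw [adjugate_fin_succ_eq_det_submatrix, charpoly,
    charmatrix_submatrix_of_injective A Fin.succAbove_right_injective, ← two_mul, pow_mul]
  simp

theorem det_updateRow_zero_updateRow_last {k : ℕ} (M : Matrix (Fin (k + 2)) (Fin (k + 2)) R) :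
    ((M.updateRow (Fin.last _) (Pi.single (Fin.last _) 1)).updateRow 0 (Pi.single 0 1)).det =
      (M.submatrix (Fin.succ ∘ Fin.castSucc) (Fin.succ ∘ Fin.castSucc)).det := by
  have hsucc : (M.updateRow (Fin.last _) (Pi.single (Fin.last _) 1)).submatrix Fin.succ Fin.succ =
      (M.submatrix Fin.succ Fin.succ).updateRow (Fin.last _) (Pi.single (Fin.last _) 1) := by
    ext i j
    simp [updateRow_apply, Pi.single_apply, ← Fin.succ_last]
  rw [← adjugate_apply, adjugate_fin_succ_eq_det_submatrix, Fin.succAbove_zero, hsucc,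
    ← adjugate_apply, adjugate_fin_succ_eq_det_submatrix, Fin.succAbove_last, submatrix_submatrix]
  simp [← two_mul]

theorem charpoly_add_single_last_zero_add_single_zero_last {k : ℕ}
    (B : Matrix (Fin (k + 2)) (Fin (k + 2)) R) (x y : R) :
    (B + single (Fin.last _) 0 x + single 0 (Fin.last _) y).charpoly =
      B.charpoly - Polynomial.C x * (charmatrix B).adjugate 0 (Fin.last _) -
        Polynomial.C y * (charmatrix B).adjugate (Fin.last _) 0 -
        Polynomial.C (x * y) * (B.submatrix (Fin.succ ∘ Fin.castSucc)
          (Fin.succ ∘ Fin.castSucc)).charpoly := by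
  have hchar : charmatrix (B + single (Fin.last _) 0 x + single 0 (Fin.last _) y) =
      charmatrix B + single (Fin.last _) 0 (-Polynomial.C x) +
        single 0 (Fin.last _) (-Polynomial.C y) := by
    rw [← neg_map_C_single, ← neg_map_C_single]
    ext1 i j
    simp only [charmatrix_apply, Matrix.add_apply, Matrix.neg_apply, map_apply, Polynomial.C_add]
    ring
  rw [charpoly, hchar, det_add_single_add_single _ (Fin.last_pos' ).ne',
    det_updateRow_zero_updateRow_last, charmatrix_submatrix_of_injective _
      ((Fin.succ_injective _).comp (Fin.castSucc_injective _)), charpoly, charpoly,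
    Polynomial.C_mul]
  ring

theorem adjugate_charmatrix_zero_last_of_forall_eq_zero {n : ℕ}
    (A : Matrix (Fin (n + 1)) (Fin (n + 1)) R)
    (hA : ∀ i j : Fin n, i < j → A i.castSucc j.succ = 0) :
    (charmatrix A).adjugate 0 (Fin.last n) = Polynomial.C (∏ i : Fin n, A i.castSucc i.succ) := by
  rw [adjugate_fin_succ_eq_det_submatrix, det_of_isLowerTriangular]
  · have hne (i : Fin n) : i.castSucc ≠ i.succ := i.castSucc_lt_succ.ne
    simp [charmatrix_apply_ne, hne, Finset.prod_neg, ← mul_assoc, ← mul_pow]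
  · intro i j hij
    have hlt : i.castSucc < j.succ := Fin.castSucc_lt_succ_iff.2 (le_of_lt hij)
    simp [charmatrix_apply_ne _ _ _ hlt.ne, hA i j hij]

theorem adjugate_charmatrix_last_zero_of_forall_eq_zero {n : ℕ}
    (A : Matrix (Fin (n + 1)) (Fin (n + 1)) R)
    (hA : ∀ i j : Fin n, i < j → A j.succ i.castSucc = 0) :
    (charmatrix A).adjugate (Fin.last n) 0 = Polynomial.C (∏ i : Fin n, A i.succ i.castSucc) := by
  simpa only [charmatrix_transpose, ← adjugate_transpose, transpose_apply] using
    adjugate_charmatrix_zero_last_of_forall_eq_zero Aᵀ hA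

end Determinants

namespace UnitGain

open Polynomial

variable {V W : Type*} {G : SimpleGraph V} {H : SimpleGraph W}

theorem adjMatrix_of_adj (Φ : UnitGain G) {u v : V} (h : G.Adj u v) :
    Φ.adjMatrix u v = Φ.gain ⟨(u, v), h⟩ :=
  dif_pos h

theorem adjMatrix_of_not_adj (Φ : UnitGain G) {u v : V} (h : ¬G.Adj u v) : Φ.adjMatrix u v = 0 :=
  dif_neg h

theorem adjMatrix_self (Φ : UnitGain G) (v : V) : Φ.adjMatrix v v = 0 :=
  Φ.adjMatrix_of_not_adj (G.loopless.irrefl v)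

theorem adjMatrix_mul_adjMatrix_swap (Φ : UnitGain G) {u v : V} (h : G.Adj u v) :
    Φ.adjMatrix u v * Φ.adjMatrix v u = 1 := by
  rw [Φ.adjMatrix_of_adj h, Φ.adjMatrix_of_adj h.symm, ← Circle.coe_mul]
  exact congrArg _ (mul_eq_one_iff_inv_eq.2 (Φ.gain_symm ⟨(u, v), h⟩).symm)

/-- The pullback of a gain along a graph homomorphism. -/
def comap (f : H →g G) (Φ : UnitGain G) : UnitGain H where
  gain d := Φ.gain (f.mapDart d)
  gain_symm d := Φ.gain_symm (f.mapDart d)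

theorem adjMatrix_comap_of_adj (f : H →g G) (Φ : UnitGain G) {u v : W} (h : H.Adj u v) :
    (Φ.comap f).adjMatrix u v = Φ.adjMatrix (f u) (f v) :=
  ((Φ.comap f).adjMatrix_of_adj h).trans (Φ.adjMatrix_of_adj (f.map_adj h)).symm

theorem adjMatrix_comap_embedding (f : H ↪g G) (Φ : UnitGain G) :
    (Φ.comap f.toHom).adjMatrix = Φ.adjMatrix.submatrix f f := by
  ext u v
  by_cases h : H.Adj u v
  · exact Φ.adjMatrix_comap_of_adj f.toHom h
  · rw [adjMatrix_of_not_adj _ h, Matrix.submatrix_apply,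
      adjMatrix_of_not_adj _ (f.map_adj_iff.not.2 h)]

theorem charpoly_adjMatrix_of_bridge {m n : Type*} [Fintype m] [DecidableEq m] [Fintype n]
    [DecidableEq n] [Fintype V] [DecidableEq V] (Φ : UnitGain G) (e : m ⊕ n ≃ V) {a : m} {b : n}
    (hG : ∀ v w, G.Adj (e (Sum.inl v)) (e (Sum.inr w)) ↔ v = a ∧ w = b) :
    Φ.adjMatrix.charpoly =
      (Φ.adjMatrix.submatrix (e ∘ Sum.inl) (e ∘ Sum.inl)).charpoly *
        (Φ.adjMatrix.submatrix (e ∘ Sum.inr) (e ∘ Sum.inr)).charpoly -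
      (Φ.adjMatrix.submatrix (e ∘ Sum.inl) (e ∘ Sum.inl)).charmatrix.adjugate a a *
        (Φ.adjMatrix.submatrix (e ∘ Sum.inr) (e ∘ Sum.inr)).charmatrix.adjugate b b := by
  set c := Φ.adjMatrix (e (Sum.inl a)) (e (Sum.inr b)) with hc
  set d := Φ.adjMatrix (e (Sum.inr b)) (e (Sum.inl a)) with hd
  have hcd : c * d = 1 := Φ.adjMatrix_mul_adjMatrix_swap ((hG a b).2 ⟨rfl, rfl⟩)
  have hblocks : Matrix.reindex e.symm e.symm Φ.adjMatrix =
      Matrix.fromBlocks (Φ.adjMatrix.submatrix (e ∘ Sum.inl) (e ∘ Sum.inl)) (Matrix.single a b c)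
        (Matrix.single b a d) (Φ.adjMatrix.submatrix (e ∘ Sum.inr) (e ∘ Sum.inr)) := by
    ext (v | w) (v' | w')
    · rfl
    · by_cases h : v = a ∧ w' = b
      · obtain ⟨rfl, rfl⟩ := h
        simp [hc]
      · simp [Φ.adjMatrix_of_not_adj (mt (hG v w').1 h), eq_comm (a := a),
          eq_comm (a := b), h]
    · by_cases h : v' = a ∧ w = b
      · obtain ⟨rfl, rfl⟩ := h
        simp [hd]
      · simp [Φ.adjMatrix_of_not_adj (mt (fun hadj => (hG v' w).1 hadj.symm) h),
          eq_comm (a := a), eq_comm (a := b), and_comm (a := w = b), h]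
    · rfl
  rw [← Matrix.charpoly_reindex e.symm, hblocks, charpoly_fromBlocks_single_single, hcd, C_1,
    one_mul]

theorem charpoly_adjMatrix_of_pendant {n : ℕ} {G : SimpleGraph (Fin (n + 2))} (Φ : UnitGain G)
    (hG : ∀ i : Fin (n + 1), G.Adj i.castSucc (Fin.last (n + 1)) ↔ i = Fin.last n) :
    Φ.adjMatrix.charpoly = X * (Φ.adjMatrix.submatrix Fin.castSucc Fin.castSucc).charpoly -
      (Φ.adjMatrix.submatrix (Fin.castSucc ∘ Fin.castSucc)
        (Fin.castSucc ∘ Fin.castSucc)).charpoly := by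
  let e : Fin (n + 1) ⊕ Fin 1 ≃ Fin (n + 2) := finSumFinEquiv
  have hinl : e ∘ Sum.inl = Fin.castSucc := by
    ext
    simp [e]
  have hbridge (i : Fin (n + 1)) (j : Fin 1) :
      G.Adj (e (Sum.inl i)) (e (Sum.inr j)) ↔ i = Fin.last n ∧ j = 0 := by
    rw [Subsingleton.elim j 0, and_iff_left rfl]
    exact hG i
  rw [Φ.charpoly_adjMatrix_of_bridge e hbridge, hinl, adjugate_charmatrix_apply_self,
    adjugate_charmatrix_apply_self,
    Matrix.charpoly_isEmpty (n := Fin 0), mul_one, mul_comm,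
    Fin.succAbove_last, Matrix.submatrix_submatrix]
  simp [Matrix.charpoly, adjMatrix_self]

theorem charpoly_adjMatrix_submatrix_castLE {N m : ℕ} {G : SimpleGraph (Fin N)} (Φ : UnitGain G)
    (hm : m + 1 ≤ N) {k : ℕ} (hk : m + k ≤ N)
    (hG : ∀ i j : Fin N, m < (j : ℕ) → (j : ℕ) < m + k → i < j → (G.Adj i j ↔ (i : ℕ) + 1 = j)) :
    (Φ.adjMatrix.submatrix (Fin.castLE hk) (Fin.castLE hk)).charpoly =
      (Φ.adjMatrix.submatrix (Fin.castLE hm) (Fin.castLE hm)).charpoly *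
          Chebyshev.S ℂ ((k : ℤ) - 1) -
        (Φ.adjMatrix.submatrix (Fin.castLE (Nat.le_of_succ_le hm))
          (Fin.castLE (Nat.le_of_succ_le hm))).charpoly * Chebyshev.S ℂ ((k : ℤ) - 2) := by
  induction k using Nat.twoStepInduction with
  | zero => simp
  | one => simp
  | more k ih₀ ih₁ =>
    let f := SimpleGraph.Embedding.comap (Fin.castLEEmb hk) G
    have hpendant := (Φ.comap f.toHom).charpoly_adjMatrix_of_pendant (n := m + k) fun i => by
      have hadj := hG (Fin.castLE hk i.castSucc) (Fin.castLE hk (Fin.last _)) (by simp)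
        (Nat.lt_succ_self _) (Fin.lt_def.2 i.isLt)
      exact hadj.trans (by simp [Fin.ext_iff, ← add_assoc])
    rw [adjMatrix_comap_embedding] at hpendant
    refine hpendant.trans ?_
    have h₁ := ih₁ (by omega) fun i j hj hjk => hG i j hj (by omega)
    have h₀ := ih₀ (by omega) fun i j hj hjk => hG i j hj (by omega)
    push_cast at h₁ ⊢
    rw [Matrix.submatrix_submatrix, Matrix.submatrix_submatrix]
    refine (congrArg₂ (X * · - ·) h₁ h₀).trans ?_
    have hS := Chebyshev.S_add_two ℂ ((k : ℤ) - 1)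
    have hS' := Chebyshev.S_add_two ℂ ((k : ℤ) - 2)
    ring_nf at hS hS' ⊢
    rw [hS, hS']
    ring

/-- The path `0, …, n - 1` as an induced subgraph of the path `0, …, n`. -/
def pathGraphCastSucc (n : ℕ) : SimpleGraph.pathGraph n ↪g SimpleGraph.pathGraph (n + 1) where
  toEmbedding := Fin.castSuccEmb
  map_rel_iff' := by simp [SimpleGraph.pathGraph_adj]

theorem charpoly_adjMatrix_pathGraph {n : ℕ} (Φ : UnitGain (SimpleGraph.pathGraph n)) :
    Φ.adjMatrix.charpoly = Chebyshev.S ℂ n := by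
  induction n using Nat.twoStepInduction with
  | zero => simp [Matrix.charpoly_isEmpty]
  | one => simp [Matrix.charpoly, adjMatrix_self]
  | more n ih₀ ih₁ =>
    have h₁ := ih₁ (Φ.comap (pathGraphCastSucc (n + 1)).toHom)
    have h₀ := ih₀ (Φ.comap ((pathGraphCastSucc (n + 1)).comp (pathGraphCastSucc n)).toHom)
    rw [adjMatrix_comap_embedding] at h₀ h₁
    push_cast at h₁ ⊢
    rw [Chebyshev.S_add_two, ← h₀, ← h₁]
    refine Φ.charpoly_adjMatrix_of_pendant fun i => ?_
    simp only [SimpleGraph.pathGraph_adj, Fin.ext_iff, Fin.val_castSucc, Fin.val_last]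
    omega

theorem charpoly_adjMatrix_submatrix_pathGraph {n : ℕ} (Φ : UnitGain G)
    (f : SimpleGraph.pathGraph n ↪g G) :
    (Φ.adjMatrix.submatrix f f).charpoly = Chebyshev.S ℂ n := by
  rw [← adjMatrix_comap_embedding, charpoly_adjMatrix_pathGraph]

/-- The path `1, …, n` as an induced subgraph of the path `0, …, n + 1`. -/
def pathGraphInner (n : ℕ) : SimpleGraph.pathGraph n ↪g SimpleGraph.pathGraph (n + 2) where
  toEmbedding := Fin.castSuccEmb.trans (Fin.succEmb (n + 1))
  map_rel_iff' := by simp [SimpleGraph.pathGraph_adj]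

theorem adjMatrix_cycleGraph_eq_add {n : ℕ} (hn : 2 ≤ n)
    (Φ : UnitGain (SimpleGraph.cycleGraph (n + 1))) :
    Φ.adjMatrix = (Φ.comap (SimpleGraph.Hom.ofLE SimpleGraph.pathGraph_le_cycleGraph)).adjMatrix +
      Matrix.single (Fin.last n) 0 (Φ.adjMatrix (Fin.last n) 0) +
      Matrix.single 0 (Fin.last n) (Φ.adjMatrix 0 (Fin.last n)) := by
  have hlast : Fin.last n ≠ 0 := Fin.last_eq_zero_iff.not.2 (by omega)
  have hpath : ¬(SimpleGraph.pathGraph (n + 1)).Adj 0 (Fin.last n) := by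
    simp only [SimpleGraph.pathGraph_adj, Fin.val_zero, Fin.val_last]
    omega
  ext i j
  by_cases hlast_zero : Fin.last n = i ∧ 0 = j
  · obtain ⟨rfl, rfl⟩ := hlast_zero
    simp [hlast, hlast.symm, adjMatrix_of_not_adj _ fun h => hpath h.symm]
  by_cases hzero_last : 0 = i ∧ Fin.last n = j
  · obtain ⟨rfl, rfl⟩ := hzero_last
    simp [hlast, hlast.symm, adjMatrix_of_not_adj _ hpath]
  by_cases hadj : (SimpleGraph.pathGraph (n + 1)).Adj i j
  · simp [hlast_zero, hzero_last, adjMatrix_comap_of_adj _ _ hadj]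
  · have hcycle : ¬(SimpleGraph.cycleGraph (n + 1)).Adj i j := by
      rw [cycleGraph_adj_val (by omega)]
      simp only [SimpleGraph.pathGraph_adj, Fin.ext_iff, Fin.val_zero, Fin.val_last] at *
      omega
    simp [hlast_zero, hzero_last, adjMatrix_of_not_adj _ hadj, adjMatrix_of_not_adj _ hcycle]

theorem coe_cycleGain {n : ℕ} (hn : 3 ≤ n) (Φ : UnitGain G) (c : SimpleGraph.cycleGraph n ↪g G) :
    (Φ.cycleGain hn c : ℂ) = ∏ i, Φ.adjMatrix (c i) (c (finRotate n i)) :=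
  (map_prod Circle.coeHom _ _).trans <| Finset.prod_congr rfl fun i _ =>
    (Φ.adjMatrix_of_adj (c.map_adj_iff.2 (cycleDart n hn i).adj)).symm

theorem coe_cycleGain_refl_eq_prod_mul {n : ℕ} (hn : 3 ≤ n + 1)
    (Φ : UnitGain (SimpleGraph.cycleGraph (n + 1))) :
    (Φ.cycleGain hn SimpleGraph.Embedding.refl : ℂ) =
      (∏ i : Fin n, Φ.adjMatrix i.castSucc i.succ) * Φ.adjMatrix (Fin.last n) 0 := by
  rw [coe_cycleGain, Fin.prod_univ_castSucc]
  simp [Fin.coeSucc_eq_succ]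

theorem charpoly_adjMatrix_cycleGraph {n : ℕ} (hn : 3 ≤ n + 2)
    (Φ : UnitGain (SimpleGraph.cycleGraph (n + 2))) :
    Φ.adjMatrix.charpoly = Chebyshev.C ℂ (n + 2 : ℕ) -
      C (2 * (Φ.cycleGain hn SimpleGraph.Embedding.refl : ℂ).re : ℂ) := by
  set γ : ℂ := ↑(Φ.cycleGain hn SimpleGraph.Embedding.refl)
  set Ψ := Φ.comap (SimpleGraph.Hom.ofLE SimpleGraph.pathGraph_le_cycleGraph)
  set x := Φ.adjMatrix (Fin.last (n + 1)) 0
  set y := Φ.adjMatrix 0 (Fin.last (n + 1))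
  have hxy : x * y = 1 := Φ.adjMatrix_mul_adjMatrix_swap <|
    (cycleGraph_adj_val hn _ _).2 (Or.inr (Or.inr (Or.inr ⟨rfl, rfl⟩)))
  have hadj (i : Fin (n + 1)) : (SimpleGraph.pathGraph (n + 2)).Adj i.castSucc i.succ := by
    simp [SimpleGraph.pathGraph_adj]
  have hnonadj (i j : Fin (n + 1)) (hij : i < j) :
      ¬(SimpleGraph.pathGraph (n + 2)).Adj i.castSucc j.succ := by
    simp only [SimpleGraph.pathGraph_adj, Fin.val_castSucc, Fin.val_succ]
    omega
  have hγ : γ = x * ∏ i : Fin (n + 1), Ψ.adjMatrix i.castSucc i.succ := by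
    rw [mul_comm, Finset.prod_congr rfl fun i _ => adjMatrix_comap_of_adj _ Φ (hadj i)]
    exact Φ.coe_cycleGain_refl_eq_prod_mul hn
  have hγ_conj : starRingEnd ℂ γ = y * ∏ i : Fin (n + 1), Ψ.adjMatrix i.succ i.castSucc := by
    rw [hγ, map_mul, map_prod]
    exact congrArg₂ _ (Φ.adjMatrix_isHermitian.apply _ _)
      (Finset.prod_congr rfl fun i _ => Ψ.adjMatrix_isHermitian.apply _ _)
  have hinner : (Ψ.adjMatrix.submatrix (Fin.succ ∘ Fin.castSucc)
      (Fin.succ ∘ Fin.castSucc)).charpoly = Chebyshev.S ℂ n :=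
    Ψ.charpoly_adjMatrix_submatrix_pathGraph (pathGraphInner n)
  rw [adjMatrix_cycleGraph_eq_add (by omega) Φ,
    charpoly_add_single_last_zero_add_single_zero_last, charpoly_adjMatrix_pathGraph, hinner, hxy,
    adjugate_charmatrix_zero_last_of_forall_eq_zero _ fun i j hij =>
      adjMatrix_of_not_adj _ (hnonadj i j hij),
    adjugate_charmatrix_last_zero_of_forall_eq_zero _ fun i j hij =>
      adjMatrix_of_not_adj _ fun h => hnonadj i j hij h.symm,
    ← C_mul, ← C_mul, ← hγ, ← hγ_conj, sub_sub _ (C γ), ← C_add, Complex.add_conj,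
    Chebyshev.C_eq_S_sub_X_mul_S]
  have hS := Chebyshev.S_add_two ℂ n
  push_cast
  rw [C_1, one_mul, show (n : ℤ) + 2 - 1 = n + 1 by ring, show (n : ℤ) + 1 + 1 = n + 2 by ring]
  linear_combination -hS

theorem charpoly_adjMatrix_submatrix_cycleGraph {n : ℕ} (hn : 3 ≤ n) (Φ : UnitGain G)
    (c : SimpleGraph.cycleGraph n ↪g G) :
    (Φ.adjMatrix.submatrix c c).charpoly =
      Chebyshev.C ℂ n - C (2 * (Φ.cycleGain hn c : ℂ).re : ℂ) := by
  obtain ⟨m, rfl⟩ := Nat.exists_eq_add_of_le' (Nat.le_of_succ_le hn)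
  rw [← adjMatrix_comap_embedding, charpoly_adjMatrix_cycleGraph hn]
  rfl

/-- The path `0, …, n - 1` as an induced subgraph of the cycle on `0, …, n`. -/
def cycleGraphCastSucc {n : ℕ} (hn : 2 ≤ n) :
    SimpleGraph.pathGraph n ↪g SimpleGraph.cycleGraph (n + 1) where
  toEmbedding := Fin.castSuccEmb
  map_rel_iff' {i j} := by
    rw [cycleGraph_adj_val (by omega)]
    simp only [SimpleGraph.pathGraph_adj, Fin.coe_castSuccEmb, Fin.val_castSucc]
    omega

/-- The path `1, …, n` as an induced subgraph of the cycle on `0, …, n`. -/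
def cycleGraphSucc {n : ℕ} (hn : 2 ≤ n) :
    SimpleGraph.pathGraph n ↪g SimpleGraph.cycleGraph (n + 1) where
  toEmbedding := Fin.succEmb n
  map_rel_iff' {i j} := by
    rw [cycleGraph_adj_val (by omega)]
    simp [SimpleGraph.pathGraph_adj]

theorem charpoly_adjMatrix_submatrix_cycleGraph_castSucc {n : ℕ} (hn : 2 ≤ n) (Φ : UnitGain G)
    (c : SimpleGraph.cycleGraph (n + 1) ↪g G) :
    (Φ.adjMatrix.submatrix (c ∘ Fin.castSucc) (c ∘ Fin.castSucc)).charpoly = Chebyshev.S ℂ n :=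
  Φ.charpoly_adjMatrix_submatrix_pathGraph (c.comp (cycleGraphCastSucc hn))

theorem charpoly_adjMatrix_submatrix_cycleGraph_succ {n : ℕ} (hn : 2 ≤ n) (Φ : UnitGain G)
    (c : SimpleGraph.cycleGraph (n + 1) ↪g G) :
    (Φ.adjMatrix.submatrix (c ∘ Fin.succ) (c ∘ Fin.succ)).charpoly = Chebyshev.S ℂ n :=
  Φ.charpoly_adjMatrix_submatrix_pathGraph (c.comp (cycleGraphSucc hn))

theorem charpoly_adjMatrix_dumbbell_submatrix_castLE {p s ℓ k : ℕ} (hp : 3 ≤ p + 1) (hs : 3 ≤ s)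
    (hk : k ≤ ℓ) (hpk : p + k ≤ p + 1 + s + ℓ - 1) (Φ : UnitGain (dumbbell (p + 1) s ℓ)) :
    (Φ.adjMatrix.submatrix (Fin.castLE hpk) (Fin.castLE hpk)).charpoly =
      (Φ.adjMatrix.submatrix (dumbbellLeft (p + 1) s ℓ hp hs)
          (dumbbellLeft (p + 1) s ℓ hp hs)).charpoly * Chebyshev.S ℂ ((k : ℤ) - 1) -
        Chebyshev.S ℂ p * Chebyshev.S ℂ ((k : ℤ) - 2) := by
  rw [← Φ.charpoly_adjMatrix_submatrix_cycleGraph_castSucc (by omega)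
    (dumbbellLeft (p + 1) s ℓ hp hs)]
  refine Φ.charpoly_adjMatrix_submatrix_castLE (by omega) hpk fun i j hj hjk hij => ?_
  simp only [dumbbell, SimpleGraph.fromRel_adj, ne_eq, Fin.ext_iff]
  omega

theorem charpoly_adjMatrix_dumbbell {r s ℓ : ℕ} (hr : 3 ≤ r) (hs : 3 ≤ s) (hℓ : 1 ≤ ℓ)
    (Φ : UnitGain (dumbbell r s ℓ)) :
    let P := (Φ.adjMatrix.submatrix (dumbbellLeft r s ℓ hr hs) (dumbbellLeft r s ℓ hr hs)).charpoly
    let Q :=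
      (Φ.adjMatrix.submatrix (dumbbellRight r s ℓ hr hs) (dumbbellRight r s ℓ hr hs)).charpoly
    Φ.adjMatrix.charpoly =
      (P * Chebyshev.S ℂ ((ℓ : ℤ) - 1) -
          Chebyshev.S ℂ ((r : ℤ) - 1) * Chebyshev.S ℂ ((ℓ : ℤ) - 2)) * Q -
        (P * Chebyshev.S ℂ ((ℓ : ℤ) - 2) -
          Chebyshev.S ℂ ((r : ℤ) - 1) * Chebyshev.S ℂ ((ℓ : ℤ) - 3)) *
            Chebyshev.S ℂ ((s : ℤ) - 1) := by
  intro P Q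
  obtain ⟨p, rfl⟩ := Nat.exists_eq_add_of_le' (Nat.one_le_of_lt hr)
  obtain ⟨q, rfl⟩ := Nat.exists_eq_add_of_le' (Nat.one_le_of_lt hs)
  obtain ⟨l, rfl⟩ := Nat.exists_eq_add_of_le' hℓ
  let e : Fin (p + l + 1) ⊕ Fin (q + 1) ≃ Fin (p + 1 + (q + 1) + (l + 1) - 1) :=
    finSumFinEquiv.trans (finCongr (by omega))
  have he_inl (v : Fin (p + l + 1)) : (e (Sum.inl v) : ℕ) = v := rfl
  have he_inr (w : Fin (q + 1)) : (e (Sum.inr w) : ℕ) = p + l + 1 + w := rfl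
  have hbridge (v : Fin (p + l + 1)) (w : Fin (q + 1)) :
      (dumbbell (p + 1) (q + 1) (l + 1)).Adj (e (Sum.inl v)) (e (Sum.inr w)) ↔
        v = Fin.last (p + l) ∧ w = 0 := by
    simp only [dumbbell, SimpleGraph.fromRel_adj, ne_eq, Fin.ext_iff, he_inl, he_inr, Fin.val_last,
      Fin.val_zero]
    omega
  have hright : e ∘ Sum.inr = dumbbellRight (p + 1) (q + 1) (l + 1) hr hs := by
    ext w
    exact (he_inr w).trans (congrArg (· + (w : ℕ)) (by omega))
  have hleading {k : ℕ} (hk : k ≤ l + 1) :=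
    Φ.charpoly_adjMatrix_dumbbell_submatrix_castLE hr hs hk (by omega)
  rw [Φ.charpoly_adjMatrix_of_bridge e hbridge, hright, adjugate_charmatrix_apply_self,
    adjugate_charmatrix_apply_self, Fin.succAbove_last, Fin.succAbove_zero,
    Matrix.submatrix_submatrix, Matrix.submatrix_submatrix,
    charpoly_adjMatrix_submatrix_cycleGraph_succ (by omega)]
  refine (congrArg₂ (· * Q - · * Chebyshev.S ℂ q) (hleading le_rfl)
    (hleading l.le_succ)).trans ?_
  push_cast
  rw [show (l : ℤ) - 1 = l + 1 - 2 by ring, show (l : ℤ) - 2 = l + 1 - 3 by ring,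
    add_sub_cancel_right (p : ℤ), add_sub_cancel_right (q : ℤ)]

theorem chebyshevS_mul_charpoly_adjMatrix_dumbbell {r s ℓ : ℕ} (hr : 3 ≤ r) (hs : 3 ≤ s)
    (hℓ : 1 ≤ ℓ) (Φ : UnitGain (dumbbell r s ℓ)) :
    Chebyshev.S ℂ ((ℓ : ℤ) - 1) * Φ.adjMatrix.charpoly =
      ((Chebyshev.C ℂ r - C (2 * (Φ.cycleGain hr (dumbbellLeft r s ℓ hr hs) : ℂ).re : ℂ)) *
          Chebyshev.S ℂ ((ℓ : ℤ) - 1) -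
        Chebyshev.S ℂ ((r : ℤ) - 1) * Chebyshev.S ℂ ((ℓ : ℤ) - 2)) *
      ((Chebyshev.C ℂ s - C (2 * (Φ.cycleGain hs (dumbbellRight r s ℓ hr hs) : ℂ).re : ℂ)) *
          Chebyshev.S ℂ ((ℓ : ℤ) - 1) -
        Chebyshev.S ℂ ((s : ℤ) - 1) * Chebyshev.S ℂ ((ℓ : ℤ) - 2)) -
      Chebyshev.S ℂ ((r : ℤ) - 1) * Chebyshev.S ℂ ((s : ℤ) - 1) := by
  rw [Φ.charpoly_adjMatrix_dumbbell hr hs hℓ, charpoly_adjMatrix_submatrix_cycleGraph hr,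
    charpoly_adjMatrix_submatrix_cycleGraph hs]
  have hS := Chebyshev.S_add_two ℂ ((ℓ : ℤ) - 3)
  have hcassini := Chebyshev.S_sq_add_S_sq ℂ ((ℓ : ℤ) - 2)
  rw [show (ℓ : ℤ) - 3 + 2 = ℓ - 1 by ring, show (ℓ : ℤ) - 3 + 1 = ℓ - 2 by ring] at hS
  rw [show (ℓ : ℤ) - 2 + 1 = ℓ - 1 by ring] at hcassini
  linear_combination Chebyshev.S ℂ ((r : ℤ) - 1) * Chebyshev.S ℂ ((s : ℤ) - 1) *
    (Chebyshev.S ℂ ((ℓ : ℤ) - 1) * hS - hcassini)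

end UnitGain

section Fibonacci

open Polynomial Complex

/-- The value at `t` of the `n`-th Fibonacci polynomial, which up to a power of `I` is the value of
the Chebyshev polynomial `S (n - 1)` at `I * t`. -/
def fibonacciEval (t : ℝ) : ℕ → ℝ
  | 0 => 0
  | 1 => 1
  | n + 2 => t * fibonacciEval t (n + 1) + fibonacciEval t n

theorem fibonacciEval_succ_pos_and_nonneg {t : ℝ} (ht : 0 < t) (n : ℕ) :
    0 < fibonacciEval t (n + 1) ∧ 0 ≤ fibonacciEval t n := by
  induction n with
  | zero => simp [fibonacciEval]
  | succ n ih =>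
    rw [fibonacciEval]
    exact ⟨add_pos_of_pos_of_nonneg (mul_pos ht ih.1) ih.2, ih.1.le⟩

theorem fibonacciEval_pos {t : ℝ} (ht : 0 < t) {n : ℕ} (hn : 0 < n) : 0 < fibonacciEval t n := by
  obtain ⟨m, rfl⟩ := Nat.exists_eq_add_of_le' hn
  exact (fibonacciEval_succ_pos_and_nonneg ht m).1

theorem I_mul_eval_chebyshevS (t : ℝ) (n : ℕ) :
    I * (Chebyshev.S ℂ ((n : ℤ) - 1)).eval (I * t) = I ^ n * fibonacciEval t n := by
  induction n using Nat.twoStepInduction with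
  | zero => simp [fibonacciEval]
  | one => simp [fibonacciEval]
  | more n ih₀ ih₁ =>
    have hS := Chebyshev.S_add_two ℂ ((n : ℤ) - 1)
    push_cast [fibonacciEval] at ih₁ ⊢
    rw [show (n : ℤ) + 1 - 1 = n - 1 + 1 by ring] at ih₁
    rw [show (n : ℤ) + 2 - 1 = n - 1 + 2 by ring, hS, eval_sub, eval_mul, eval_X]
    linear_combination I * t * ih₁ - ih₀ - I ^ n * fibonacciEval t n * I_sq

theorem eval_chebyshevC {n : ℕ} (hn : 1 ≤ n) (t : ℝ) :
    (Chebyshev.C ℂ n).eval (I * t) =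
      I ^ n * (fibonacciEval t (n + 1) + fibonacciEval t (n - 1) : ℝ) := by
  obtain ⟨m, rfl⟩ := Nat.exists_eq_add_of_le' hn
  have hC := congrArg (eval (I * t)) (Chebyshev.C_eq_S_sub_X_mul_S ℂ ((m + 1 : ℕ) : ℤ))
  have hS := I_mul_eval_chebyshevS t (m + 1)
  have hS' := I_mul_eval_chebyshevS t (m + 2)
  simp only [eval_sub, eval_mul, eval_ofNat, eval_X] at hC
  rw [show ((m + 2 : ℕ) : ℤ) - 1 = (m + 1 : ℕ) by push_cast; ring, fibonacciEval] at hS'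
  refine mul_left_cancel₀ I_ne_zero ?_
  rw [hC, Nat.add_sub_cancel, fibonacciEval]
  push_cast at hS hS' ⊢
  linear_combination 2 * hS' - I * t * hS

end Fibonacci

section Dumbbell

open Polynomial Complex

variable {r s ℓ : ℕ}

theorem sq_neg_one_pow {R : Type*} [Ring R] (n : ℕ) : ((-1 : R) ^ n) ^ 2 = 1 := by
  rw [← pow_mul, (even_two.mul_left n).neg_one_pow]

/-- The contribution of one end of the dumbbell `D_{r,s,ℓ}` to its characteristic polynomial at
`it`: for odd `r` and `t > 0` this is `|P(it) S_{ℓ-1}(it) - S_{r-1}(it) S_{ℓ-2}(it)|`, where `P` is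
the characteristic polynomial of a gain on `C_r` whose cycle gain has real part `0`. -/
def dumbbellEndEval (r ℓ : ℕ) (t : ℝ) : ℝ :=
  (fibonacciEval t (r + 1) + fibonacciEval t (r - 1)) * fibonacciEval t ℓ +
    fibonacciEval t r * fibonacciEval t (ℓ - 1)

theorem I_pow_of_odd (hr : Odd r) : I ^ r = -(-1) ^ ((r + 1) / 2) * I := by
  obtain ⟨k, rfl⟩ := hr
  rw [show (2 * k + 1 + 1) / 2 = k + 1 by omega, pow_succ, pow_mul, I_sq]
  ring

theorem eval_chebyshevS_of_odd (hr : Odd r) (t : ℝ) :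
    (Chebyshev.S ℂ ((r : ℤ) - 1)).eval (I * t) = -(-1) ^ ((r + 1) / 2) * fibonacciEval t r :=
  mul_left_cancel₀ I_ne_zero (by rw [I_mul_eval_chebyshevS, I_pow_of_odd hr]; ring)

theorem I_mul_eval_dumbbellEnd (hr : 1 ≤ r) (hr_odd : Odd r) (hℓ : 1 ≤ ℓ) (γ t : ℝ) :
    I * ((Chebyshev.C ℂ r - C (2 * γ : ℂ)) * Chebyshev.S ℂ ((ℓ : ℤ) - 1) -
        Chebyshev.S ℂ ((r : ℤ) - 1) * Chebyshev.S ℂ ((ℓ : ℤ) - 2)).eval (I * t) =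
      -(-1) ^ ((r + 1) / 2) * I ^ ℓ *
        (2 * fibonacciEval t ℓ * ((-1) ^ ((r + 1) / 2) * γ : ℝ) + dumbbellEndEval r ℓ t * I) := by
  obtain ⟨l, rfl⟩ := Nat.exists_eq_add_of_le' hℓ
  set ε : ℂ := (-1) ^ ((r + 1) / 2) with hε
  have hε_sq : ε ^ 2 = 1 := sq_neg_one_pow _
  have hI_pow : I ^ r = -ε * I := I_pow_of_odd hr_odd
  have hS_succ := I_mul_eval_chebyshevS t (l + 1)
  have hS := I_mul_eval_chebyshevS t l
  rw [show ((l + 1 : ℕ) : ℤ) - 2 = l - 1 by push_cast; ring]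
  simp only [eval_sub, eval_mul, eval_C, eval_chebyshevC hr, hI_pow,
    eval_chebyshevS_of_odd hr_odd, dumbbellEndEval, Nat.add_sub_cancel]
  push_cast [← hε] at hS_succ ⊢
  linear_combination
    (-ε * I * (fibonacciEval t (r + 1) + fibonacciEval t (r - 1)) - 2 * γ) * hS_succ +
      ε * fibonacciEval t r * hS + 2 * γ * fibonacciEval t (l + 1) * I ^ (l + 1) * hε_sq +
      ε * fibonacciEval t r * fibonacciEval t l * I ^ l * I_sq

theorem abs_oddAlpha_le_one (hr : 3 ≤ r) (hs : 3 ≤ s) (Φ : UnitGain (dumbbell r s ℓ)) :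
    |oddAlpha hr hs Φ| ≤ 1 := by
  rw [oddAlpha, abs_mul, abs_neg_one_pow, one_mul]
  exact (Complex.abs_re_le_norm _).trans (Circle.norm_coe _).le

theorem abs_oddBeta_le_one (hr : 3 ≤ r) (hs : 3 ≤ s) (Φ : UnitGain (dumbbell r s ℓ)) :
    |oddBeta hr hs Φ| ≤ 1 := by
  rw [oddBeta, abs_mul, abs_neg_one_pow, one_mul]
  exact (Complex.abs_re_le_norm _).trans (Circle.norm_coe _).le

theorem neg_one_pow_mul_oddAlpha_mul_oddBeta_le_one (hr : 3 ≤ r) (hs : 3 ≤ s)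
    (Φ : UnitGain (dumbbell r s ℓ)) : (-1) ^ ℓ * (oddAlpha hr hs Φ * oddBeta hr hs Φ) ≤ 1 := by
  refine (le_abs_self _).trans ?_
  rw [abs_mul, abs_neg_one_pow, one_mul, abs_mul]
  exact mul_le_one₀ (abs_oddAlpha_le_one hr hs Φ) (abs_nonneg _) (abs_oddBeta_le_one hr hs Φ)

theorem eval_charpoly_dumbbell (hr : 3 ≤ r) (hs : 3 ≤ s) (hℓ : 1 ≤ ℓ) (hr_odd : Odd r)
    (hs_odd : Odd s) (Φ : UnitGain (dumbbell r s ℓ)) (t : ℝ) :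
    I ^ (ℓ + 1) * (fibonacciEval t ℓ * Φ.adjMatrix.charpoly.eval (I * t)) =
      (-1) ^ ((r + 1) / 2) * (-1) ^ ((s + 1) / 2) * (-1) ^ ℓ *
        ((2 * fibonacciEval t ℓ * oddAlpha hr hs Φ + dumbbellEndEval r ℓ t * I) *
            (2 * fibonacciEval t ℓ * oddBeta hr hs Φ + dumbbellEndEval s ℓ t * I) +
          (-1) ^ ℓ * (fibonacciEval t r * fibonacciEval t s)) := by
  set ε : ℂ := (-1) ^ ((r + 1) / 2) with hε
  set δ : ℂ := (-1) ^ ((s + 1) / 2) with hδ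
  set x : ℂ := 2 * fibonacciEval t ℓ * oddAlpha hr hs Φ + dumbbellEndEval r ℓ t * I
  set y : ℂ := 2 * fibonacciEval t ℓ * oddBeta hr hs Φ + dumbbellEndEval s ℓ t * I
  have hcharpoly := congrArg (eval (I * t)) (Φ.chebyshevS_mul_charpoly_adjMatrix_dumbbell hr hs hℓ)
  have hleft := I_mul_eval_dumbbellEnd (by omega) hr_odd hℓ
    (Φ.cycleGain hr (dumbbellLeft r s ℓ hr hs) : ℂ).re t
  have hright := I_mul_eval_dumbbellEnd (by omega) hs_odd hℓ
    (Φ.cycleGain hs (dumbbellRight r s ℓ hr hs) : ℂ).re t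
  rw [← oddAlpha, ← hε] at hleft
  rw [← oddBeta, ← hδ] at hright
  rw [eval_mul, eval_sub, eval_mul, eval_mul, eval_chebyshevS_of_odd hr_odd,
    eval_chebyshevS_of_odd hs_odd, ← hε, ← hδ] at hcharpoly
  have hI_pow : I ^ ℓ * I ^ ℓ = (-1) ^ ℓ := by rw [← mul_pow, I_mul_I]
  have hsign : ((-1 : ℂ) ^ ℓ) ^ 2 = 1 := sq_neg_one_pow ℓ
  calc I ^ (ℓ + 1) * (fibonacciEval t ℓ * Φ.adjMatrix.charpoly.eval (I * t))
      = I * I * ((Chebyshev.S ℂ ((ℓ : ℤ) - 1)).eval (I * t) *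
          Φ.adjMatrix.charpoly.eval (I * t)) := by
        linear_combination -I * Φ.adjMatrix.charpoly.eval (I * t) * I_mul_eval_chebyshevS t ℓ
    _ = -ε * I ^ ℓ * x * (-δ * I ^ ℓ * y) -
          I * I * (-ε * fibonacciEval t r * (-δ * fibonacciEval t s)) := by
        rw [hcharpoly, mul_sub, mul_mul_mul_comm, hleft, hright]
    _ = ε * δ * (-1) ^ ℓ * (x * y + (-1) ^ ℓ * (fibonacciEval t r * fibonacciEval t s)) := by
        linear_combination ε * δ * x * y * hI_pow -
          ε * δ * fibonacciEval t r * fibonacciEval t s * (I_sq + hsign)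

theorem normSq_eval_charpoly_dumbbell (hr : 3 ≤ r) (hs : 3 ≤ s) (hℓ : 1 ≤ ℓ) (hr_odd : Odd r)
    (hs_odd : Odd s) (Φ : UnitGain (dumbbell r s ℓ)) (t : ℝ) :
    fibonacciEval t ℓ ^ 2 * normSq (Φ.adjMatrix.charpoly.eval (I * t)) =
      normSq ((2 * fibonacciEval t ℓ * oddAlpha hr hs Φ + dumbbellEndEval r ℓ t * I) *
          (2 * fibonacciEval t ℓ * oddBeta hr hs Φ + dumbbellEndEval s ℓ t * I) +
        (-1) ^ ℓ * (fibonacciEval t r * fibonacciEval t s)) := by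
  have h := congrArg normSq (eval_charpoly_dumbbell hr hs hℓ hr_odd hs_odd Φ t)
  simpa only [normSq_mul, map_pow, normSq_I, normSq_neg, normSq_one, one_pow, one_mul,
    normSq_ofReal, ← sq] using h

theorem normSq_mul_add (σ u x y κ α β : ℝ) :
    normSq ((2 * u * α + x * I) * (2 * u * β + y * I) + σ * κ) =
      (x * y - σ * κ) ^ 2 + 16 * u ^ 4 * (α ^ 2 * β ^ 2) +
        4 * u ^ 2 * (y ^ 2 * α ^ 2 + x ^ 2 * β ^ 2) + 8 * u ^ 2 * κ * (σ * (α * β)) := by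
  simp only [normSq_apply, add_re, add_im, mul_re, mul_im, ofReal_re, ofReal_im, I_re, I_im,
    re_ofNat, im_ofNat]
  ring

theorem sq_eq_one_of_mul_mul_eq_one {σ α β : ℝ} (hσ : σ ^ 2 = 1) (hα : |α| ≤ 1) (hβ : |β| ≤ 1)
    (h : σ * (α * β) = 1) : α ^ 2 = 1 ∧ β ^ 2 = 1 := by
  have hα_sq := (sq_le_one_iff_abs_le_one α).2 hα
  have hβ_sq := (sq_le_one_iff_abs_le_one β).2 hβ
  have hprod : α ^ 2 * β ^ 2 = 1 := by
    linear_combination (σ * (α * β) + 1) * h - α ^ 2 * β ^ 2 * hσ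
  exact ⟨hα_sq.antisymm (hprod.symm.trans_le (mul_le_of_le_one_right (sq_nonneg α) hβ_sq)),
    hβ_sq.antisymm (hprod.symm.trans_le (mul_le_of_le_one_left (sq_nonneg β) hα_sq))⟩

theorem normSq_mul_add_add_le {σ α β α' β' : ℝ} (u x y κ : ℝ) (hσ : σ ^ 2 = 1) (hα : |α| ≤ 1)
    (hβ : |β| ≤ 1) (h : σ * (α * β) = 1) (hα' : |α'| ≤ 1) (hβ' : |β'| ≤ 1) :
    normSq ((2 * u * α' + x * I) * (2 * u * β' + y * I) + σ * κ) +
        8 * u ^ 2 * κ * (1 - σ * (α' * β')) ≤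
      normSq ((2 * u * α + x * I) * (2 * u * β + y * I) + σ * κ) := by
  obtain ⟨hα_sq, hβ_sq⟩ := sq_eq_one_of_mul_mul_eq_one hσ hα hβ h
  have hα'_sq := (sq_le_one_iff_abs_le_one α').2 hα'
  have hβ'_sq := (sq_le_one_iff_abs_le_one β').2 hβ'
  have hquartic : 16 * u ^ 4 * (α' ^ 2 * β' ^ 2) ≤ 16 * u ^ 4 * 1 := by
    gcongr
    exact mul_le_one₀ hα'_sq (sq_nonneg _) hβ'_sq
  have hquadratic : 4 * u ^ 2 * (y ^ 2 * α' ^ 2 + x ^ 2 * β' ^ 2) ≤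
      4 * u ^ 2 * (y ^ 2 * 1 + x ^ 2 * 1) := by
    gcongr
  rw [normSq_mul_add, normSq_mul_add, h, hα_sq, hβ_sq]
  linarith

theorem normSq_eval_charpoly_dumbbell_add_le (hr : 3 ≤ r) (hs : 3 ≤ s) (hℓ : 1 ≤ ℓ)
    (hr_odd : Odd r) (hs_odd : Odd s) {Φ : UnitGain (dumbbell r s ℓ)}
    (hΦ : (-1) ^ ℓ * (oddAlpha hr hs Φ * oddBeta hr hs Φ) = 1) (Ψ : UnitGain (dumbbell r s ℓ))
    {t : ℝ} (ht : 0 < t) :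
    normSq (Ψ.adjMatrix.charpoly.eval (I * t)) +
        8 * (fibonacciEval t r * fibonacciEval t s) *
          (1 - (-1) ^ ℓ * (oddAlpha hr hs Ψ * oddBeta hr hs Ψ)) ≤
      normSq (Φ.adjMatrix.charpoly.eval (I * t)) := by
  have hle := normSq_mul_add_add_le (fibonacciEval t ℓ) (dumbbellEndEval r ℓ t)
    (dumbbellEndEval s ℓ t) (fibonacciEval t r * fibonacciEval t s) (sq_neg_one_pow ℓ)
    (abs_oddAlpha_le_one hr hs Φ) (abs_oddBeta_le_one hr hs Φ) hΦ
    (abs_oddAlpha_le_one hr hs Ψ) (abs_oddBeta_le_one hr hs Ψ)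
  push_cast at hle
  rw [← normSq_eval_charpoly_dumbbell hr hs hℓ hr_odd hs_odd,
    ← normSq_eval_charpoly_dumbbell hr hs hℓ hr_odd hs_odd] at hle
  refine le_of_mul_le_mul_left ?_ (pow_pos (fibonacciEval_pos ht hℓ) 2)
  linear_combination hle

theorem energy_le_of_mul_eq_one (hr : 3 ≤ r) (hs : 3 ≤ s) (hℓ : 1 ≤ ℓ) (hr_odd : Odd r)
    (hs_odd : Odd s) {Φ : UnitGain (dumbbell r s ℓ)}
    (hΦ : (-1) ^ ℓ * (oddAlpha hr hs Φ * oddBeta hr hs Φ) = 1) (Ψ : UnitGain (dumbbell r s ℓ)) :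
    Ψ.energy ≤ Φ.energy := by
  refine sum_abs_eigenvalues_le_of_normSq_le _ _ fun t ht => ?_
  have hle := normSq_eval_charpoly_dumbbell_add_le hr hs hℓ hr_odd hs_odd hΦ Ψ ht
  have hr_pos : 0 < fibonacciEval t r := fibonacciEval_pos ht (by omega)
  have hs_pos : 0 < fibonacciEval t s := fibonacciEval_pos ht (by omega)
  have hΨ := sub_nonneg.2 (neg_one_pow_mul_oddAlpha_mul_oddBeta_le_one hr hs Ψ)
  exact (le_add_of_nonneg_right (by positivity)).trans hle

theorem energy_lt_of_mul_eq_one_of_mul_ne_one (hr : 3 ≤ r) (hs : 3 ≤ s) (hℓ : 1 ≤ ℓ)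
    (hr_odd : Odd r) (hs_odd : Odd s) {Φ Ψ : UnitGain (dumbbell r s ℓ)}
    (hΦ : (-1) ^ ℓ * (oddAlpha hr hs Φ * oddBeta hr hs Φ) = 1)
    (hΨ : (-1) ^ ℓ * (oddAlpha hr hs Ψ * oddBeta hr hs Ψ) ≠ 1) :
    Ψ.energy < Φ.energy := by
  refine sum_abs_eigenvalues_lt_of_normSq_lt _ _ fun t ht => ?_
  have hle := normSq_eval_charpoly_dumbbell_add_le hr hs hℓ hr_odd hs_odd hΦ Ψ ht
  have hr_pos : 0 < fibonacciEval t r := fibonacciEval_pos ht (by omega)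
  have hs_pos : 0 < fibonacciEval t s := fibonacciEval_pos ht (by omega)
  have hΨ_pos := sub_pos.2 ((neg_one_pow_mul_oddAlpha_mul_oddBeta_le_one hr hs Ψ).lt_of_ne hΨ)
  exact (lt_add_of_pos_right _ (by positivity)).trans_le hle

end Dumbbell

section Extremal

variable {V : Type*} {G : SimpleGraph V}

/-- The gain whose value on an oriented edge is the quotient of the values of an arbitrary function
at the two orientations; it serves to prescribe gains edge by edge. -/
noncomputable def UnitGain.ofFun (G : SimpleGraph V) (w : V → V → Circle) : UnitGain G where
  gain d := w d.fst d.snd * (w d.snd d.fst)⁻¹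
  gain_symm d := by rw [mul_inv, inv_inv, mul_comm]; rfl

theorem UnitGain.cycleGain_ofFun_of_forall_eq_one {n : ℕ} (hn : 3 ≤ n + 1) (w : V → V → Circle)
    (c : SimpleGraph.cycleGraph (n + 1) ↪g G)
    (hsucc : ∀ i : Fin n, w (c i.castSucc) (c i.succ) = 1)
    (hpred : ∀ i : Fin n, w (c i.succ) (c i.castSucc) = 1) (hlast : w (c 0) (c (Fin.last n)) = 1) :
    (UnitGain.ofFun G w).cycleGain hn c = w (c (Fin.last n)) (c 0) := by
  have hgain (i : Fin (n + 1)) :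
      (UnitGain.ofFun G w).gain (c.toHom.mapDart (cycleDart (n + 1) hn i)) =
        w (c i) (c (finRotate (n + 1) i)) * (w (c (finRotate (n + 1) i)) (c i))⁻¹ := rfl
  have hrotate (i : Fin n) : finRotate (n + 1) i.castSucc = i.succ := by
    rw [finRotate_apply, Fin.coeSucc_eq_succ]
  rw [UnitGain.cycleGain, Fin.prod_univ_castSucc, Finset.prod_eq_one, one_mul, hgain,
    finRotate_last, hlast, inv_one, mul_one]
  intro i _
  rw [hgain, hrotate, hsucc, hpred, inv_one, mul_one]

/-- The gain on the dumbbell graph with the given gains on the oriented edges that close the two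
cycles and gain `1` elsewhere. -/
noncomputable def dumbbellGain (r s ℓ : ℕ) (γ δ : Circle) : UnitGain (dumbbell r s ℓ) :=
  UnitGain.ofFun _ fun u v =>
    if (u : ℕ) + 1 = r ∧ (v : ℕ) = 0 then γ
    else if (u : ℕ) + 2 = r + s + ℓ ∧ (v : ℕ) + 1 = r + ℓ then δ
    else 1

variable {r s ℓ : ℕ}

theorem cycleGain_dumbbellLeft_dumbbellGain (hr : 3 ≤ r) (hs : 3 ≤ s) (γ δ : Circle) :
    (dumbbellGain r s ℓ γ δ).cycleGain hr (dumbbellLeft r s ℓ hr hs) = γ := by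
  obtain ⟨n, rfl⟩ := Nat.exists_eq_add_of_le' (Nat.one_le_of_lt hr)
  have hval (i : Fin (n + 1)) : (dumbbellLeft (n + 1) s ℓ hr hs i : ℕ) = i := rfl
  rw [dumbbellGain, UnitGain.cycleGain_ofFun_of_forall_eq_one hr]
  · simp [hval]
  all_goals
    intros
    simp only [hval, Fin.val_castSucc, Fin.val_succ, Fin.val_zero, Fin.val_last]
    rw [if_neg (by omega), if_neg (by omega)]

theorem cycleGain_dumbbellRight_dumbbellGain (hr : 3 ≤ r) (hs : 3 ≤ s) (hℓ : 1 ≤ ℓ)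
    (γ δ : Circle) :
    (dumbbellGain r s ℓ γ δ).cycleGain hs (dumbbellRight r s ℓ hr hs) = δ := by
  obtain ⟨n, rfl⟩ := Nat.exists_eq_add_of_le' (Nat.one_le_of_lt hs)
  have hval (i : Fin (n + 1)) : (dumbbellRight r (n + 1) ℓ hr hs i : ℕ) = r + ℓ - 1 + i := rfl
  rw [dumbbellGain, UnitGain.cycleGain_ofFun_of_forall_eq_one hs]
  · simp only [hval, Fin.val_zero, Fin.val_last]
    rw [if_neg (by omega), if_pos (by omega)]
  all_goals
    intros
    simp only [hval, Fin.val_castSucc, Fin.val_succ, Fin.val_zero, Fin.val_last]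
    rw [if_neg (by omega), if_neg (by omega)]

theorem exists_circle_re_eq {x : ℝ} (hx : |x| ≤ 1) : ∃ z : Circle, (z : ℂ).re = x := by
  obtain ⟨hx_neg, hx_one⟩ := abs_le.1 hx
  exact ⟨Circle.exp (Real.arccos x), by
    rw [Circle.coe_exp, Complex.exp_ofReal_mul_I_re, Real.cos_arccos hx_neg hx_one]⟩

theorem exists_oddAlpha_eq_oddBeta_eq (hr : 3 ≤ r) (hs : 3 ≤ s) (hℓ : 1 ≤ ℓ) {x y : ℝ}
    (hx : |x| ≤ 1) (hy : |y| ≤ 1) :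
    ∃ Φ : UnitGain (dumbbell r s ℓ), oddAlpha hr hs Φ = x ∧ oddBeta hr hs Φ = y := by
  have habs {z : ℝ} (hz : |z| ≤ 1) (n : ℕ) : |(-1) ^ n * z| ≤ 1 := by
    rwa [abs_mul, abs_neg_one_pow, one_mul]
  have hsign (n : ℕ) (z : ℝ) : (-1) ^ n * ((-1) ^ n * z) = z := by
    rw [← mul_assoc, ← sq, sq_neg_one_pow, one_mul]
  obtain ⟨γ, hγ⟩ := exists_circle_re_eq (habs hx ((r + 1) / 2))
  obtain ⟨δ, hδ⟩ := exists_circle_re_eq (habs hy ((s + 1) / 2))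
  refine ⟨dumbbellGain r s ℓ γ δ, ?_, ?_⟩
  · rw [oddAlpha, cycleGain_dumbbellLeft_dumbbellGain, hγ, hsign]
  · rw [oddBeta, cycleGain_dumbbellRight_dumbbellGain hr hs hℓ, hδ, hsign]

theorem forall_energy_le_iff (hr : 3 ≤ r) (hs : 3 ≤ s) (hℓ : 1 ≤ ℓ) (hr_odd : Odd r)
    (hs_odd : Odd s) (Φ : UnitGain (dumbbell r s ℓ)) :
    (∀ Ψ : UnitGain (dumbbell r s ℓ), Ψ.energy ≤ Φ.energy) ↔
      (-1) ^ ℓ * (oddAlpha hr hs Φ * oddBeta hr hs Φ) = 1 := by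
  refine ⟨fun hmax => ?_, energy_le_of_mul_eq_one hr hs hℓ hr_odd hs_odd⟩
  by_contra hΦ
  obtain ⟨Ψ, hα, hβ⟩ := exists_oddAlpha_eq_oddBeta_eq (x := 1) (y := (-1) ^ ℓ) hr hs hℓ
    abs_one.le (abs_neg_one_pow ℓ).le
  have hΨ : (-1) ^ ℓ * (oddAlpha hr hs Ψ * oddBeta hr hs Ψ) = 1 := by
    rw [hα, hβ, one_mul, ← sq, sq_neg_one_pow]
  exact (energy_lt_of_mul_eq_one_of_mul_ne_one hr hs hℓ hr_odd hs_odd hΨ hΦ).not_ge (hmax Ψ)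

theorem mul_eq_one_iff_of_abs_le_one {x y : ℝ} (hx : |x| ≤ 1) (hy : |y| ≤ 1) :
    x * y = 1 ↔ (x = 1 ∧ y = 1) ∨ (x = -1 ∧ y = -1) := by
  refine ⟨fun h => ?_, by rintro (⟨rfl, rfl⟩ | ⟨rfl, rfl⟩) <;> norm_num⟩
  obtain ⟨hx_sq, -⟩ := sq_eq_one_of_mul_mul_eq_one (one_pow 2) hx hy (by rwa [one_mul])
  rcases sq_eq_one_iff.1 hx_sq with rfl | rfl
  · exact Or.inl ⟨rfl, by linarith⟩
  · exact Or.inr ⟨rfl, by linarith⟩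

theorem neg_one_pow_mul_mul_eq_one_iff_of_even {x y : ℝ} (hℓ : Even ℓ) (hx : |x| ≤ 1)
    (hy : |y| ≤ 1) :
    (-1) ^ ℓ * (x * y) = 1 ↔ (x = 1 ∧ y = 1) ∨ (x = -1 ∧ y = -1) := by
  rw [hℓ.neg_one_pow, one_mul, mul_eq_one_iff_of_abs_le_one hx hy]

theorem neg_one_pow_mul_mul_eq_one_iff_of_odd {x y : ℝ} (hℓ : Odd ℓ) (hx : |x| ≤ 1)
    (hy : |y| ≤ 1) :
    (-1) ^ ℓ * (x * y) = 1 ↔ (x = 1 ∧ y = -1) ∨ (x = -1 ∧ y = 1) := by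
  rw [hℓ.neg_one_pow, neg_one_mul, ← mul_neg,
    mul_eq_one_iff_of_abs_le_one hx ((abs_neg y).trans_le hy), neg_eq_iff_eq_neg, neg_inj]

end Extremal

theorem mainTheorem5 (r s ℓ : ℕ) (hr : 3 ≤ r) (hs : 3 ≤ s) (hℓ : 1 ≤ ℓ)
    (hr_odd : Odd r) (hs_odd : Odd s) :
    (Even ℓ →
      (∀ Φ : UnitGain (dumbbell r s ℓ),
        (∀ Ψ : UnitGain (dumbbell r s ℓ), Ψ.energy ≤ Φ.energy) ↔
          (oddAlpha hr hs Φ = 1 ∧ oddBeta hr hs Φ = 1) ∨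
          (oddAlpha hr hs Φ = -1 ∧ oddBeta hr hs Φ = -1)) ∧
      (∃ Φ : UnitGain (dumbbell r s ℓ), oddAlpha hr hs Φ = 1 ∧ oddBeta hr hs Φ = 1) ∧
      (∃ Φ : UnitGain (dumbbell r s ℓ), oddAlpha hr hs Φ = -1 ∧ oddBeta hr hs Φ = -1)) ∧
    (Odd ℓ →
      (∀ Φ : UnitGain (dumbbell r s ℓ),
        (∀ Ψ : UnitGain (dumbbell r s ℓ), Ψ.energy ≤ Φ.energy) ↔
          (oddAlpha hr hs Φ = 1 ∧ oddBeta hr hs Φ = -1) ∨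
          (oddAlpha hr hs Φ = -1 ∧ oddBeta hr hs Φ = 1)) ∧
      (∃ Φ : UnitGain (dumbbell r s ℓ), oddAlpha hr hs Φ = 1 ∧ oddBeta hr hs Φ = -1) ∧
      (∃ Φ : UnitGain (dumbbell r s ℓ), oddAlpha hr hs Φ = -1 ∧ oddBeta hr hs Φ = 1)) := by
  refine ⟨fun hℓ_even => ⟨fun Φ => ?_, ?_, ?_⟩, fun hℓ_odd => ⟨fun Φ => ?_, ?_, ?_⟩⟩
  · rw [forall_energy_le_iff hr hs hℓ hr_odd hs_odd, neg_one_pow_mul_mul_eq_one_iff_of_even hℓ_even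
      (abs_oddAlpha_le_one hr hs Φ) (abs_oddBeta_le_one hr hs Φ)]
  · exact exists_oddAlpha_eq_oddBeta_eq hr hs hℓ (by simp) (by simp)
  · exact exists_oddAlpha_eq_oddBeta_eq hr hs hℓ (by simp) (by simp)
  · rw [forall_energy_le_iff hr hs hℓ hr_odd hs_odd, neg_one_pow_mul_mul_eq_one_iff_of_odd hℓ_odd
      (abs_oddAlpha_le_one hr hs Φ) (abs_oddBeta_le_one hr hs Φ)]
  · exact exists_oddAlpha_eq_oddBeta_eq hr hs hℓ (by simp) (by simp)
  · exact exists_oddAlpha_eq_oddBeta_eq hr hs hℓ (by simp) (by simp)
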